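/- Let $M$ and $\Sigma$ be connected (Hausdorff, boundaryless) smooth manifolds of the same dimension $n$, let $\langle\cdot,\cdot\rangle_M$ be a smooth Riemannian metric on $M$, and let $-\mathbb{R}\times_{e^t}M$ denote the product manifold $\mathbb{R}\times M$ endowed with the Lorentzian metric \[ \langle\cdot,\cdot\rangle=-\pi_{\mathbb{R}}^*(dt^2)+e^{2t}\,\pi_M^*(\langle\cdot,\cdot\rangle_M), \] where $\pi_{\mathbb{R}}$ and $\pi_M$ are the projections of $\mathbb{R}\times M$ onto its factors. Let $\psi:\Sigma\to-\mathbb{R}\times_{e^t}M$ be a complete spacelike hypersurface, that is, a smooth immersion such that $\psi^*\langle\cdot,\cdot\rangle$ is a complete Riemannian metric on $\Sigma$. Suppose that $\psi$ is bounded away from the future infinity, that is, there exists $\overline{t}\in\mathbb{R}$ such that $\psi(\Sigma)\subset\{(t,x)\in\mathbb{R}\times M: t\le\overline{t}\}$. Then $(M,\langle\cdot,\cdot\rangle_M)$ is complete, and the projection $\Pi=\pi_M\circ\psi:\Sigma\to M$ is a smooth covering map, that is, a surjective covering map which is a local diffeomorphism. -/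

import Mathlib

open Bundle Manifold Filter
open scoped ContDiff Topology ENNReal

noncomputable section

namespace SteadyState

/-- A smooth Riemannian metric on a smooth `n`-dimensional manifold (without boundary). -/
abbrev SmoothMetric (n : ℕ) (M : Type*) [TopologicalSpace M]
    [ChartedSpace (EuclideanSpace ℝ (Fin n)) M] [IsManifold (𝓡 n) ∞ M] :=
  ContMDiffRiemannianMetric (𝓡 n) ∞ (EuclideanSpace ℝ (Fin n))
    (fun x : M ↦ TangentSpace (𝓡 n) x)

section Distance

variable {n : ℕ} {M : Type*} [TopologicalSpace M] [ChartedSpace (EuclideanSpace ℝ (Fin n)) M]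
  [IsManifold (𝓡 n) ∞ M]

/-- The Riemannian distance of `g`: the infimum of the `g`-lengths of the `C^1` paths from `x`
to `y`. -/
def riemDist (g : RiemannianMetric (fun x : M ↦ TangentSpace (𝓡 n) x)) (x y : M) : ℝ≥0∞ :=
  letI : RiemannianBundle (fun x : M ↦ TangentSpace (𝓡 n) x) := ⟨g⟩
  riemannianEDist (𝓡 n) x y

/-- Completeness of a Riemannian metric: each sequence that is Cauchy for the Riemannian distance
converges for it. -/
def IsCompleteMetric (g : RiemannianMetric (fun x : M ↦ TangentSpace (𝓡 n) x)) : Prop :=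
  ∀ u : ℕ → M,
    (∀ ε : ℝ≥0∞, 0 < ε → ∃ N : ℕ, ∀ i ≥ N, ∀ j ≥ N, riemDist g (u i) (u j) < ε) →
    ∃ x : M, Tendsto (fun i ↦ riemDist g (u i) x) atTop (𝓝 0)

end Distance

section Spacetime

variable {n : ℕ} {M : Type*} [TopologicalSpace M] [ChartedSpace (EuclideanSpace ℝ (Fin n)) M]
  [IsManifold (𝓡 n) ∞ M]

/-- The differential `dt` of the projection `π_ℝ : ℝ × M → ℝ`. -/
def dTime (q : ℝ × M) : TangentSpace (𝓘(ℝ, ℝ).prod (𝓡 n)) q →L[ℝ] ℝ :=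
  mfderiv (𝓘(ℝ, ℝ).prod (𝓡 n)) 𝓘(ℝ, ℝ) (Prod.fst : ℝ × M → ℝ) q

/-- The differential of the projection `π_M : ℝ × M → M`. -/
def dSpace (q : ℝ × M) : TangentSpace (𝓘(ℝ, ℝ).prod (𝓡 n)) q →L[ℝ] TangentSpace (𝓡 n) q.2 :=
  mfderiv (𝓘(ℝ, ℝ).prod (𝓡 n)) (𝓡 n) (Prod.snd : ℝ × M → M) q

/-- The Lorentzian metric `-π_ℝ^*(dt²) + e^{2t} π_M^*(g)` of `-ℝ ×_{e^t} M` at the point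
`q = (t, x)` of `ℝ × M`. -/
def lorentz (g : SmoothMetric n M) (q : ℝ × M)
    (v w : TangentSpace (𝓘(ℝ, ℝ).prod (𝓡 n)) q) : ℝ :=
  -(dTime (n := n) q v * dTime (n := n) q w) +
    Real.exp (2 * q.1) * g.inner q.2 (dSpace q v) (dSpace q w)

variable {S : Type*} [TopologicalSpace S] [ChartedSpace (EuclideanSpace ℝ (Fin n)) S]

/-- The pullback by `ψ` of the Lorentzian metric of `-ℝ ×_{e^t} M`, at `p`. -/
def pullback (g : SmoothMetric n M) (ψ : S → ℝ × M) (p : S) (v w : TangentSpace (𝓡 n) p) : ℝ :=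
  lorentz g (ψ p) (mfderiv (𝓡 n) (𝓘(ℝ, ℝ).prod (𝓡 n)) ψ p v)
    (mfderiv (𝓡 n) (𝓘(ℝ, ℝ).prod (𝓡 n)) ψ p w)

/-- `ψ : S → -ℝ ×_{e^t} M` is a spacelike hypersurface: it is smooth and the pulled back metric is
Riemannian, that is, positive definite (so that `ψ` is an immersion). -/
structure IsSpacelike (g : SmoothMetric n M) (ψ : S → ℝ × M) : Prop where
  contMDiff : ContMDiff (𝓡 n) (𝓘(ℝ, ℝ).prod (𝓡 n)) ∞ ψ
  pos : ∀ (p : S) (v : TangentSpace (𝓡 n) p), v ≠ 0 → 0 < pullback g ψ p v v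

theorem pullback_symm (g : SmoothMetric n M) (ψ : S → ℝ × M) (p : S) (v w : TangentSpace (𝓡 n) p) :
    pullback g ψ p v w = pullback g ψ p w v := by
  simp only [pullback, lorentz]
  rw [g.symm, mul_comm (dTime (n := n) (ψ p) _)]

theorem pullback_add_left (g : SmoothMetric n M) (ψ : S → ℝ × M) (p : S)
    (v v' w : TangentSpace (𝓡 n) p) :
    pullback g ψ p (v + v') w = pullback g ψ p v w + pullback g ψ p v' w := by
  simp only [pullback, lorentz, map_add, add_apply]
  ring

theorem pullback_smul_left (g : SmoothMetric n M) (ψ : S → ℝ × M) (p : S) (c : ℝ)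
    (v w : TangentSpace (𝓡 n) p) :
    pullback g ψ p (c • v) w = c * pullback g ψ p v w := by
  simp only [pullback, lorentz, map_smul, smul_apply, smul_eq_mul]
  ring

/-- The pulled back metric as a bilinear form on the tangent space at `p`. -/
def pullbackForm (g : SmoothMetric n M) (ψ : S → ℝ × M) (p : S) :
    EuclideanSpace ℝ (Fin n) →L[ℝ] EuclideanSpace ℝ (Fin n) →L[ℝ] ℝ :=
  LinearMap.toContinuousLinearMap <| LinearMap.toContinuousLinearMap.toLinearMap ∘ₗ
    LinearMap.mk₂ ℝ (fun v w : EuclideanSpace ℝ (Fin n) ↦ pullback g ψ p v w)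
      (fun v v' w ↦ pullback_add_left g ψ p v v' w)
      (fun c v w ↦ pullback_smul_left g ψ p c v w)
      (fun v w w' ↦ by
        rw [pullback_symm g ψ p v w, pullback_symm g ψ p v w', ← pullback_add_left g ψ p w w' v]
        exact pullback_symm g ψ p v _)
      (fun c v w ↦ by
        rw [smul_eq_mul, pullback_symm g ψ p v w, ← pullback_smul_left g ψ p c w v]
        exact pullback_symm g ψ p v _)

theorem isVonNBounded_of_pos {E : Type*} [NormedAddCommGroup E] [NormedSpace ℝ E]
    [FiniteDimensional ℝ E] (B : E →L[ℝ] E →L[ℝ] ℝ) (hB : ∀ v, v ≠ 0 → 0 < B v v) :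
    Bornology.IsVonNBounded ℝ {v : E | B v v < 1} := by
  have hcont : Continuous fun v : E ↦ B v v := by fun_prop
  obtain ⟨c, hc, hcB⟩ : ∃ c : ℝ, 0 < c ∧ ∀ v ∈ Metric.sphere (0 : E) 1, c ≤ B v v := by
    rcases (Metric.sphere (0 : E) 1).eq_empty_or_nonempty with h | h
    · exact ⟨1, one_pos, by simp [h]⟩
    · have : ProperSpace E := FiniteDimensional.proper ℝ E
      obtain ⟨v, hv, hmin⟩ := (isCompact_sphere (0 : E) 1).exists_isMinOn h hcont.continuousOn
      exact ⟨B v v, hB v (ne_zero_of_mem_unit_sphere ⟨v, hv⟩), fun w hw ↦ hmin hw⟩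
  rw [NormedSpace.isVonNBounded_iff]
  refine (Metric.isBounded_ball (x := (0 : E)) (r := (1 + 1 / c))).subset fun v hv ↦ ?_
  rw [mem_ball_zero_iff]
  have hv' : B v v < 1 := hv
  rcases eq_or_ne v 0 with rfl | h0
  · simp; positivity
  have hn : 0 < ‖v‖ := norm_pos_iff.2 h0
  have h1 := hcB (‖v‖⁻¹ • v) (by simp [norm_smul, hn.ne'])
  simp only [map_smul, smul_apply, smul_eq_mul] at h1
  have h2 : c * ‖v‖ ^ 2 ≤ B v v := by
    have h3 : ‖v‖⁻¹ * (‖v‖⁻¹ * B v v) * ‖v‖ ^ 2 = B v v := by field_simp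
    calc c * ‖v‖ ^ 2 ≤ ‖v‖⁻¹ * (‖v‖⁻¹ * B v v) * ‖v‖ ^ 2 := by gcongr
      _ = _ := h3
  have h4 : ‖v‖ ^ 2 < 1 / c := by
    rw [lt_div_iff₀ hc]; linarith
  nlinarith

/-- The Riemannian metric induced on `S` by a spacelike hypersurface `ψ : S → -ℝ ×_{e^t} M`; its
value on `v` and `w` is `pullback g ψ p v w`. -/
def IsSpacelike.induced {g : SmoothMetric n M} {ψ : S → ℝ × M} (h : IsSpacelike g ψ) :
    RiemannianMetric (fun p : S ↦ TangentSpace (𝓡 n) p) where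
  inner p := pullbackForm g ψ p
  symm p v w := pullback_symm g ψ p v w
  pos p v hv := h.pos p v hv
  continuousAt p :=
    (show Continuous fun v : EuclideanSpace ℝ (Fin n) ↦ pullbackForm g ψ p v v by
      fun_prop).continuousAt
  isVonNBounded p := isVonNBounded_of_pos (pullbackForm g ψ p) fun v hv ↦ h.pos p v hv

theorem IsSpacelike.induced_apply {g : SmoothMetric n M} {ψ : S → ℝ × M} (h : IsSpacelike g ψ) (p : S)
    (v w : TangentSpace (𝓡 n) p) : h.induced.inner p v w = pullback g ψ p v w := rfl

/-- `ψ(S)` lies in `{(t, x) : t ≤ T}` for some real number `T`. -/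
def IsBoundedAwayFromFuture {S M : Type*} (ψ : S → ℝ × M) : Prop :=
  ∃ T : ℝ, ∀ p : S, (ψ p).1 ≤ T

end Spacetime

end SteadyState

end

/-! Write `Π` for the projection `p ↦ (ψ p).2`. The induced metric is `e^{2t} Π^*g - dt²` along `ψ`.
Dropping the negative term and using `t ≤ T` gives `|v| ≤ e^T |dΠ v|`. Positivity of the induced
metric makes `dΠ` injective, hence bijective as the dimensions agree, so `Π` is a local
diffeomorphism by the inverse function theorem.

Completeness then forces path lifting. A partial lift of a `C^1` path over `[a, s)` is at most `e^T`
times as long as the path, so it is Cauchy at `s`, has a limit there, and can be prolonged by a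
local inverse (`IsLocalDiffeomorph.exists_lift_of_isRiemannianComplete`). Lifting the radial
segments of a chart ball trivializes `Π` over that ball, with no geodesics involved; thus `Π` is a
covering, and it is onto because `M` is connected.

Finally, a rapidly Cauchy sequence in `M` is lifted term by term along almost shortest paths. The
lifted sequence is Cauchy in `S`, and the image of its limit is the limit sought. -/

open Set

/-! ### Path lifting and evenly covered sets for local homeomorphisms -/

section Lifting

variable {E X : Type*} [TopologicalSpace E] [TopologicalSpace X] {f : E → X}

/-- A lift on `[a, s]` that ends in the source of a local inverse of `f` can be prolonged to `[a, t]`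
as long as the path stays in the target of that local inverse on `[s, t]`. -/
theorem OpenPartialHomeomorph.exists_prolonged_lift (φ : OpenPartialHomeomorph E X) (hφ : ⇑φ = f)
    {γ : ℝ → X} {Γ : ℝ → E} {a s t : ℝ} (has : a ≤ s)
    (hΓ : ContinuousOn Γ (Icc a s)) (hlift : ∀ u ∈ Icc a s, f (Γ u) = γ u)
    (hγ : ContinuousOn γ (Icc s t)) (hs : Γ s ∈ φ.source) (htarget : MapsTo γ (Icc s t) φ.target) :
    ∃ Γ' : ℝ → E, ContinuousOn Γ' (Icc a t) ∧ Γ' a = Γ a ∧ ∀ u ∈ Icc a t, f (Γ' u) = γ u := by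
  classical
  subst hφ
  have hglue : Γ s = φ.symm (γ s) := by
    rw [← hlift s ⟨has, le_rfl⟩, φ.left_inv hs]
  refine ⟨fun u ↦ if u ≤ s then Γ u else φ.symm (γ u), ?_, if_pos has, fun u hu ↦ ?_⟩
  · refine ContinuousOn.if ?_ (hΓ.mono ?_) ((φ.continuousOn_symm.comp hγ htarget).mono ?_)
    · rintro u ⟨-, hu⟩
      have : u = s := by
        simpa using (frontier_le_subset_eq continuous_id continuous_const hu)
      rw [this, hglue]
    · rintro u ⟨hu, hu'⟩
      exact ⟨hu.1, (closure_le_eq continuous_id continuous_const).subset hu'⟩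
    · rintro u ⟨hu, hu'⟩
      simp only [not_le] at hu'
      exact ⟨closure_lt_subset_le continuous_const continuous_id hu', hu.2⟩
  · dsimp only
    split_ifs with h
    · exact hlift u ⟨hu.1, h⟩
    · exact φ.right_inv (htarget ⟨(not_le.1 h).le, hu.2⟩)

/-- A path lifts through a local homeomorphism as soon as each partial lift, defined on a
half-open interval, has a cluster point at the missing endpoint. -/
theorem IsLocalHomeomorph.exists_lift_of_forall_mapClusterPt [T2Space E] [T2Space X]
    (hf : IsLocalHomeomorph f) {γ : ℝ → X} {a b : ℝ} (hab : a ≤ b) (hγ : ContinuousOn γ (Icc a b))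
    {e : E} (he : f e = γ a)
    (hcluster : ∀ s ∈ Ioc a b, ∀ Γ : ℝ → E, ContinuousOn Γ (Ico a s) →
      (∀ u ∈ Ico a s, f (Γ u) = γ u) → ∃ x, MapClusterPt x (𝓝[<] s) Γ) :
    ∃ Γ : ℝ → E, ContinuousOn Γ (Icc a b) ∧ Γ a = e ∧ ∀ u ∈ Icc a b, f (Γ u) = γ u := by
  let P : Set ℝ := {s | ∃ Γ : ℝ → E, ContinuousOn Γ (Icc a s) ∧ Γ a = e ∧
    ∀ u ∈ Icc a s, f (Γ u) = γ u}
  have mono : ∀ s ∈ P, ∀ t ≤ s, t ∈ P := fun s ⟨Γ, h1, h2, h3⟩ t hts ↦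
    ⟨Γ, h1.mono (Icc_subset_Icc_right hts), h2, fun u hu ↦ h3 u ⟨hu.1, hu.2.trans hts⟩⟩
  have haP : a ∈ P := ⟨fun _ ↦ e, continuousOn_const, rfl, by simpa using he⟩
  have key : ∀ s ∈ Ioc a b, (∀ t < s, t ∈ P) → s ∈ P := by
    intro s hs hlt
    have : Nonempty E := ⟨e⟩
    choose! G hG1 hG2 hG3 using hlt
    -- Lifts with the same origin agree, so the chosen partial lifts are compatible and the diagonal
    -- `u ↦ G u u` is one continuous lift on `[a, s)`.
    have hEq : ∀ t < s, a ≤ t → ∀ u ∈ Icc a t, G u u = G t u := by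
      intro t ht hat u hu
      have hus : u < s := hu.2.trans_lt ht
      exact (T2Space.isSeparatedMap f).eqOn_of_comp_eqOn hf.isLocallyInjective
        (isPreconnected_Icc (a := a) (b := u)) (hG1 u hus)
        ((hG1 t ht).mono (Icc_subset_Icc_right hu.2))
        (fun w hw ↦ (hG3 u hus w hw).trans (hG3 t ht w ⟨hw.1, hw.2.trans hu.2⟩).symm)
        (left_mem_Icc.2 hu.1) ((hG2 u hus).trans (hG2 t ht).symm) (right_mem_Icc.2 hu.1)
    have hcont : ContinuousOn (fun u ↦ G u u) (Ico a s) := by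
      intro u hu
      obtain ⟨t, hut, hts⟩ := exists_between hu.2
      have h1 : ContinuousWithinAt (fun u ↦ G u u) (Icc a t) u :=
        ((hG1 t hts).congr (fun w hw ↦ hEq t hts (hu.1.trans hut.le) w hw)) u ⟨hu.1, hut.le⟩
      refine h1.mono_of_mem_nhdsWithin ?_
      filter_upwards [self_mem_nhdsWithin, mem_nhdsWithin_of_mem_nhds (Iio_mem_nhds hut)]
        with w hw hw'
      exact ⟨hw.1, hw'.le⟩
    obtain ⟨x, hx⟩ := hcluster s hs _ hcont fun u hu ↦ hG3 u hu.2 u ⟨hu.1, le_rfl⟩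
    have hsIcc : s ∈ Icc a b := ⟨hs.1.le, hs.2⟩
    have hγs : Tendsto γ (𝓝[<] s) (𝓝 (γ s)) := by
      have := hγ s hsIcc
      refine this.mono_left (nhdsWithin_le_of_mem ?_)
      filter_upwards [Ioo_mem_nhdsLT hs.1] with w hw using ⟨hw.1.le, hw.2.le.trans hs.2⟩
    have hlift : (fun u ↦ f (G u u)) =ᶠ[𝓝[<] s] γ := by
      filter_upwards [Ioo_mem_nhdsLT hs.1] with w hw using hG3 w hw.2 w ⟨hw.1.le, le_rfl⟩
    have hfx : f x = γ s := by
      have h1 : MapClusterPt (f x) (𝓝[<] s) (fun u ↦ f (G u u)) :=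
        hx.continuousAt_comp hf.continuous.continuousAt
      have h2 : Tendsto (fun u ↦ f (G u u)) (𝓝[<] s) (𝓝 (γ s)) := hγs.congr' hlift.symm
      by_contra hne
      exact NeBot.ne (ClusterPt.mono h1 h2) (disjoint_iff.1 (disjoint_nhds_nhds.2 hne))
    obtain ⟨φ, hxφ, rfl⟩ := hf x
    have htgt : φ.target ∈ 𝓝 (γ s) := φ.open_target.mem_nhds (hfx ▸ φ.map_source hxφ)
    obtain ⟨c, hc, hcs⟩ : ∃ c < s, ∀ u ∈ Ioc c s, u ∈ Icc a b → γ u ∈ φ.target := by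
      have h1 : ∀ᶠ u in 𝓝 s, u ∈ Icc a b → γ u ∈ φ.target :=
        eventually_nhdsWithin_iff.1 ((hγ s hsIcc).eventually htgt)
      obtain ⟨c, hc, h2⟩ := exists_Ioc_subset_of_mem_nhds h1 ⟨a, hs.1⟩
      exact ⟨c, hc, fun u hu ↦ h2 hu⟩
    -- A cluster point is enough: a single time `t` close to `s` with the lift in `φ.source` lets
    -- the local inverse take over on `[t, s]`.
    obtain ⟨t, ht, htc, hta⟩ : ∃ t, G t t ∈ φ.source ∧ t ∈ Ioo c s ∧ t ∈ Ioo a s := by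
      have h1 := hx.frequently (φ.open_source.mem_nhds hxφ)
      obtain ⟨t, ht⟩ := (h1.and_eventually
        (inter_mem (Ioo_mem_nhdsLT hc) (Ioo_mem_nhdsLT hs.1))).exists
      exact ⟨t, ht.1, ht.2⟩
    obtain ⟨Γ', h1, h2, h3⟩ := φ.exists_prolonged_lift rfl hta.1.le (hG1 t hta.2)
      (hG3 t hta.2) (hγ.mono (Icc_subset_Icc hta.1.le hs.2)) ht
      (fun u hu ↦ hcs u ⟨htc.1.trans_le hu.1, hu.2⟩ ⟨hta.1.le.trans hu.1, hu.2.trans hs.2⟩)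
    exact ⟨Γ', h1, h2.trans (hG2 t hta.2), h3⟩
  -- Continuous induction on `[a, b]`: `P` is closed by `key`, and a local inverse at `Γ s` prolongs
  -- a lift to the right of `s`.
  have hclosed : IsClosed (P ∩ Icc a b) := by
    refine isClosed_of_closure_subset fun s hs ↦ ?_
    have hsI : s ∈ Icc a b := isClosed_Icc.closure_subset (closure_mono inter_subset_right hs)
    refine ⟨?_, hsI⟩
    rcases hsI.1.eq_or_lt with rfl | hlt
    · exact haP
    refine key s ⟨hlt, hsI.2⟩ fun t ht ↦ ?_
    obtain ⟨w, hw, hw'⟩ := mem_closure_iff.1 hs (Ioi t) isOpen_Ioi ht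
    exact mono w hw'.1 t (le_of_lt hw)
  refine (hclosed.Icc_subset_of_forall_mem_nhdsWithin haP ?_) (right_mem_Icc.2 hab)
  rintro s ⟨⟨Γ, h1, h2, h3⟩, hs⟩
  obtain ⟨φ, hxφ, rfl⟩ := hf (Γ s)
  have hsIcc : s ∈ Icc a b := ⟨hs.1, hs.2.le⟩
  have htgt : φ.target ∈ 𝓝 (γ s) :=
    φ.open_target.mem_nhds (h3 s ⟨hs.1, le_rfl⟩ ▸ φ.map_source hxφ)
  have h4 : ∀ᶠ u in 𝓝 s, u ∈ Icc a b → γ u ∈ φ.target :=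
    eventually_nhdsWithin_iff.1 ((hγ s hsIcc).eventually htgt)
  obtain ⟨c, hc, h5⟩ := exists_Ico_subset_of_mem_nhds h4 ⟨b, hs.2⟩
  filter_upwards [Ioo_mem_nhdsGT hc, Ioo_mem_nhdsGT hs.2] with t ht ht'
  obtain ⟨Γ', h1', h2', h3'⟩ := φ.exists_prolonged_lift rfl hs.1 h1 h3
    (hγ.mono (Icc_subset_Icc hs.1 ht'.2.le)) hxφ
    (fun u hu ↦ h5 ⟨hu.1, hu.2.trans_lt ht.2⟩ ⟨hs.1.trans hu.1, hu.2.trans ht'.2.le⟩)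
  exact ⟨Γ', h1', h2'.trans h2, h3'⟩

open unitInterval in
/-- Let `c` be a contraction of an open set `U` to the point `x`. If the paths of `c` can be lifted
through the local homeomorphism `f`, both from any lift of their origin and from any lift of their
end, then `x` is evenly covered. -/
theorem IsLocalHomeomorph.isEvenlyCovered_of_contraction [T2Space E] (hf : IsLocalHomeomorph f)
    {x : X} {U : Set X} (hU : IsOpen U) (hxU : x ∈ U) (c : C(I × U, X)) (hc₀ : ∀ y, c (0, y) = x)
    (hc₁ : ∀ y, c (1, y) = y)
    (hlift₀ : ∀ (y : U) (e : E), f e = x → ∃ Γ : C(I, E), Γ 0 = e ∧ ∀ t, f (Γ t) = c (t, y))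
    (hlift₁ : ∀ (y : U) (e : E), f e = y → ∃ Γ : C(I, E), Γ 1 = e ∧ ∀ t, f (Γ t) = c (t, y)) :
    IsEvenlyCovered f x (f ⁻¹' {x}) := by
  have hdisc : DiscreteTopology (f ⁻¹' {x}) :=
    (IsDiscrete.of_openPartialHomeomorph f subset_rfl fun e _ ↦
      let ⟨φ, h, h'⟩ := hf e; ⟨φ, h, h'.symm⟩).1
  -- The trivialization sends `e` over `U` to `f e` and the origin of the lift `K` ending at `e`;
  -- its inverse follows the lift `G` outward from the fibre. Uniqueness of lifts makes them
  -- mutually inverse.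
  have sep : IsSeparatedMap f := T2Space.isSeparatedMap f
  choose G hG₀ hG using fun q : U × (f ⁻¹' {x}) ↦ hlift₀ q.1 q.2 q.2.2
  choose K hK₁ hK using fun q : f ⁻¹' U ↦ hlift₁ ⟨f q, q.2⟩ q rfl
  have hGcont : Continuous fun q : I × (U × (f ⁻¹' {x})) ↦ G q.2 q.1 :=
    hf.continuous_lift sep (⟨fun q ↦ c (q.1, q.2.1), by fun_prop⟩ : C(I × (U × (f ⁻¹' {x})), X))
      (funext fun q ↦ hG q.2 q.1)
      (by simpa only [hG₀] using by fun_prop) fun q ↦ (G q).continuous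
  -- Joint continuity of a family of lifts is deduced from continuity at time `0`, whereas `K` is
  -- prescribed at time `1`; hence the time reversal `σ`.
  have hKcont : Continuous fun q : I × (f ⁻¹' U) ↦ K q.2 (σ q.1) :=
    hf.continuous_lift sep (⟨fun q ↦ c (σ q.1, ⟨f q.2, q.2.2⟩), by
        have := hf.continuous
        fun_prop⟩ : C(I × (f ⁻¹' U), X)) (funext fun q ↦ hK q.2 (σ q.1))
      (by simpa only [unitInterval.symm_zero, hK₁] using continuous_subtype_val)
      fun q ↦ (K q).continuous.comp continuous_symm
  have hK₀ : ∀ q, f (K q 0) = x := fun q ↦ by rw [hK, hc₀]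
  have hG₁ : ∀ q, f (G q 1) = q.1 := fun q ↦ by rw [hG, hc₁]
  have hGU : ∀ q, G q 1 ∈ f ⁻¹' U := fun q ↦ by rw [mem_preimage, hG₁]; exact q.1.2
  have uniq : ∀ (y y' : U) (Γ Γ' : C(I, E)), (∀ t, f (Γ t) = c (t, y)) →
      (∀ t, f (Γ' t) = c (t, y')) → y = y' → ∀ t₀, Γ t₀ = Γ' t₀ → Γ = Γ' := by
    rintro y _ Γ Γ' h h' rfl t₀ h₀
    exact DFunLike.coe_injective <| sep.eq_of_comp_eq hf.isLocallyInjective Γ.continuous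
      Γ'.continuous (funext fun t ↦ (h t).trans (h' t).symm) t₀ h₀
  refine ⟨hdisc, U, hxU, hU, hU.preimage hf.continuous,
    { toFun q := (⟨f q, q.2⟩, ⟨K q 0, hK₀ q⟩)
      invFun q := ⟨G q 1, hGU q⟩
      left_inv q := Subtype.ext ?_
      right_inv q := Prod.ext (Subtype.ext (hG₁ q)) (Subtype.ext ?_)
      continuous_toFun := ?_
      continuous_invFun := ?_ }, fun q ↦ rfl⟩
  · dsimp only
    rw [uniq _ _ (G (⟨f q, q.2⟩, ⟨K q 0, hK₀ q⟩)) (K q) (hG _) (hK q) rfl 0 (hG₀ _), hK₁]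
  · dsimp only
    rw [← uniq _ _ (G q) (K ⟨G q 1, hGU q⟩) (hG q) (hK _)
      (Subtype.ext (hG₁ q).symm) 1
      (hK₁ ⟨G q 1, hGU q⟩).symm, hG₀]
  · refine .prodMk (.subtype_mk (hf.continuous.comp continuous_subtype_val) _) (.subtype_mk ?_ _)
    simpa [Function.comp_def] using hKcont.comp (Continuous.prodMk_right (1 : I))
  · exact .subtype_mk (hGcont.comp (Continuous.prodMk_right (1 : I))) _

end Lifting

/-! ### The inverse function theorem on manifolds -/

section InverseFunction

variable {E : Type*} [NormedAddCommGroup E] [NormedSpace ℝ E]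
  {M : Type*} [TopologicalSpace M] [ChartedSpace E M]
  {F : Type*} [NormedAddCommGroup F] [NormedSpace ℝ F]
  {N : Type*} [TopologicalSpace N] [ChartedSpace F N] {n : WithTop ℕ∞}

/-- A chart of a `C^n` manifold is a partial diffeomorphism to the model space. -/
noncomputable def chartPartialDiffeomorph [IsManifold 𝓘(ℝ, E) n M] (x : M) :
    PartialDiffeomorph 𝓘(ℝ, E) 𝓘(ℝ, E) M E n where
  toPartialEquiv := (chartAt E x).toPartialEquiv
  open_source := (chartAt E x).open_source
  open_target := (chartAt E x).open_target
  contMDiffOn_toFun := contMDiffOn_chart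
  contMDiffOn_invFun := contMDiffOn_chart_symm

/-- An open partial homeomorphism that is `C^n` with invertible derivatives is a partial
diffeomorphism. -/
noncomputable def OpenPartialHomeomorph.toPartialDiffeomorph [CompleteSpace E]
    (φ : OpenPartialHomeomorph E F) (hφ : ContDiffOn ℝ n φ φ.source)
    (hφ' : ∀ x ∈ φ.source, ∃ A : E ≃L[ℝ] F, HasFDerivAt φ (A : E →L[ℝ] F) x) :
    PartialDiffeomorph 𝓘(ℝ, E) 𝓘(ℝ, F) E F n where
  toPartialEquiv := φ.toPartialEquiv
  open_source := φ.open_source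
  open_target := φ.open_target
  contMDiffOn_toFun := hφ.contMDiffOn
  contMDiffOn_invFun := ContDiffOn.contMDiffOn fun y hy ↦ by
    obtain ⟨A, hA⟩ := hφ' (φ.symm y) (φ.map_target hy)
    exact (φ.contDiffAt_symm hy hA
      (hφ.contDiffAt (φ.open_source.mem_nhds (φ.map_target hy)))).contDiffWithinAt

/-- Inverse function theorem in a normed space, as a local diffeomorphism. -/
theorem ContDiffOn.isLocalDiffeomorphAt [CompleteSpace E] {f : E → F} {s : Set E} {x : E}
    (hf : ContDiffOn ℝ n f s) (hs : IsOpen s) (hx : x ∈ s) (hn : 1 ≤ n)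
    {A : E ≃L[ℝ] F} (hA : HasFDerivAt f (A : E →L[ℝ] F) x) :
    ∃ Φ : PartialDiffeomorph 𝓘(ℝ, E) 𝓘(ℝ, F) E F n, x ∈ Φ.source ∧ EqOn f Φ Φ.source ∧
      Φ.source ⊆ s := by
  have hn0 : n ≠ 0 := (zero_lt_one.trans_le hn).ne'
  have hfx : ContDiffAt ℝ n f x := hf.contDiffAt (hs.mem_nhds hx)
  let φ := hfx.toOpenPartialHomeomorph f hA hn0
  have hderiv : ContinuousOn (fderiv ℝ f) s := hf.continuousOn_fderiv_of_isOpen hs hn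
  -- Invertible operators form an open set. Shrinking to the points with invertible derivative makes
  -- the inverse `C^n` on the whole target, not only at the image of `x`.
  let t : Set E := s ∩ fderiv ℝ f ⁻¹' range ((↑) : (E ≃L[ℝ] F) → E →L[ℝ] F)
  have ht : IsOpen t := hderiv.isOpen_inter_preimage hs ContinuousLinearEquiv.isOpen
  have hxt : x ∈ t := ⟨hx, A, hA.fderiv.symm⟩
  let φ' := φ.restrOpen t ht
  refine ⟨φ'.toPartialDiffeomorph (hf.mono fun y hy ↦ hy.2.1) fun y hy ↦ ?_,
    ⟨hfx.mem_toOpenPartialHomeomorph_source hA hn0, hxt⟩, fun y _ ↦ rfl, fun y hy ↦ hy.2.1⟩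
  obtain ⟨B, hB⟩ := hy.2.2
  refine ⟨B, ?_⟩
  rw [hB]
  exact ((hf.contDiffAt (hs.mem_nhds hy.2.1)).differentiableAt hn0).hasFDerivAt

/-- **Inverse function theorem** for manifolds without boundary: a `C^n` map is a local
diffeomorphism at each point where its differential is bijective. -/
theorem ContMDiff.isLocalDiffeomorphAt [CompleteSpace E] [CompleteSpace F]
    [IsManifold 𝓘(ℝ, E) n M] [IsManifold 𝓘(ℝ, F) n N]
    {f : M → N} (hf : ContMDiff 𝓘(ℝ, E) 𝓘(ℝ, F) n f) (hn : 1 ≤ n) {x : M}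
    (hx : Function.Bijective (mfderiv 𝓘(ℝ, E) 𝓘(ℝ, F) f x)) :
    IsLocalDiffeomorphAt 𝓘(ℝ, E) 𝓘(ℝ, F) n f x := by
  have hn0 : n ≠ 0 := (zero_lt_one.trans_le hn).ne'
  let φ := chartAt E x
  let ψ := chartAt F (f x)
  let F' : E → F := ψ ∘ f ∘ φ.symm
  let s : Set E := φ.target ∩ φ.symm ⁻¹' (f ⁻¹' ψ.source)
  have hs : IsOpen s := φ.isOpen_inter_preimage_symm (ψ.open_source.preimage hf.continuous)
  have hF' : ContDiffOn ℝ n F' s := by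
    rw [← contMDiffOn_iff_contDiffOn]
    exact contMDiffOn_chart.comp (hf.comp_contMDiffOn
      (contMDiffOn_chart_symm.mono inter_subset_left)) fun y hy ↦ hy.2
  have hxs : φ x ∈ s := ⟨mem_chart_target E x, by simp [φ, ψ]⟩
  let f' : E →L[ℝ] F := mfderiv 𝓘(ℝ, E) 𝓘(ℝ, F) f x
  have hf' : HasFDerivAt F' f' (φ x) := by
    have h : HasFDerivWithinAt (writtenInExtChartAt 𝓘(ℝ, E) 𝓘(ℝ, F) x f) f' (range 𝓘(ℝ, E))
        (extChartAt 𝓘(ℝ, E) x x) := ((hf.mdifferentiableAt hn0).hasMFDerivAt (x := x)).2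
    simpa [writtenInExtChartAt, extChartAt, F', φ, ψ, Function.comp_def] using h
  let A : E ≃L[ℝ] F := ContinuousLinearEquiv.ofBijective f'
    (LinearMap.ker_eq_bot.2 hx.1) (LinearMap.range_eq_top.2 hx.2)
  obtain ⟨Φ, hΦx, hΦ, hΦs⟩ := hF'.isLocalDiffeomorphAt hs hxs hn (A := A) hf'
  let Ψ := ((chartPartialDiffeomorph (n := n) x).trans Φ).trans
    (chartPartialDiffeomorph (n := n) (f x)).symm
  refine ⟨Ψ, ⟨⟨mem_chart_source E x, hΦx⟩, ?_⟩, ?_⟩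
  · change Φ (φ x) ∈ ψ.target
    rw [← hΦ hΦx]
    simp [F', φ, ψ]
  · rintro y ⟨⟨hy, hyΦ⟩, -⟩
    have hyφ : φ.symm (φ y) = y := φ.left_inv hy
    have hyΦ' : φ y ∈ Φ.source := hyΦ
    change f y = ψ.symm (Φ (φ y))
    have h2 := (hΦs hyΦ').2
    rw [← hΦ hyΦ']
    simp only [mem_preimage, hyφ] at h2
    simp only [F', Function.comp_apply, hyφ, ψ.left_inv h2]

end InverseFunction

/-! ### Lifting paths from a complete Riemannian manifold -/

section Riemannian

variable {E : Type*} [NormedAddCommGroup E] [NormedSpace ℝ E]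
  {M : Type*} [TopologicalSpace M] [ChartedSpace E M]
  {S : Type*} [TopologicalSpace S] [ChartedSpace E S] {n : WithTop ℕ∞} {f : S → M}

/-- A continuous lift of a `C^n` path through a local diffeomorphism is `C^n`. -/
theorem IsLocalDiffeomorph.contMDiffOn_lift (hf : IsLocalDiffeomorph 𝓘(ℝ, E) 𝓘(ℝ, E) n f)
    {γ : ℝ → M} {Γ : ℝ → S} {s : Set ℝ} (hγ : ContMDiffOn 𝓘(ℝ, ℝ) 𝓘(ℝ, E) n γ s)
    (hΓ : ContinuousOn Γ s) (hlift : ∀ t ∈ s, f (Γ t) = γ t) :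
    ContMDiffOn 𝓘(ℝ, ℝ) 𝓘(ℝ, E) n Γ s := by
  intro t ht
  have h := hf (Γ t)
  -- Near `t`, continuity keeps `Γ` in the domain of one local inverse, so `Γ` coincides with
  -- `h.localInverse ∘ γ`.
  have h1 : ContMDiffWithinAt 𝓘(ℝ, ℝ) 𝓘(ℝ, E) n (h.localInverse ∘ γ) s t := by
    refine ContMDiffAt.comp_contMDiffWithinAt t ?_ (hγ t ht)
    rw [← hlift t ht]
    exact h.localInverse_contMDiffAt
  refine h1.congr_of_eventuallyEq ?_ ?_
  · filter_upwards [self_mem_nhdsWithin, (hΓ t ht).eventually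
      (h.localInverse.open_target.mem_nhds h.localInverse_mem_target)] with u hu hu'
    rw [Function.comp_apply, ← hlift u hu, h.localInverse_left_inv hu']
  · rw [Function.comp_apply, ← hlift t ht, h.localInverse_left_inv h.localInverse_mem_target]

theorem IsLocalDiffeomorph.of_le {m : WithTop ℕ∞}
    (hf : IsLocalDiffeomorph 𝓘(ℝ, E) 𝓘(ℝ, E) n f) (hmn : m ≤ n) :
    IsLocalDiffeomorph 𝓘(ℝ, E) 𝓘(ℝ, E) m f := fun x ↦
  let ⟨Φ, hx, hΦ⟩ := hf x
  ⟨{ Φ with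
      contMDiffOn_toFun := Φ.contMDiffOn_toFun.of_le hmn
      contMDiffOn_invFun := Φ.contMDiffOn_invFun.of_le hmn }, hx, hΦ⟩

variable [RiemannianBundle (fun x : M ↦ TangentSpace 𝓘(ℝ, E) x)]

/-- The speed of a `C^1` path is bounded on compact intervals. -/
theorem exists_pathELength_le_mul_sub [IsManifold 𝓘(ℝ, E) 1 M]
    [IsContinuousRiemannianBundle E (fun x : M ↦ TangentSpace 𝓘(ℝ, E) x)]
    {γ : ℝ → M} {a b : ℝ} (hab : a < b) (hγ : ContMDiffOn 𝓘(ℝ, ℝ) 𝓘(ℝ, E) 1 γ (Icc a b)) :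
    ∃ K : NNReal, ∀ c d, a ≤ c → d ≤ b →
      pathELength 𝓘(ℝ, E) γ c d ≤ K * ENNReal.ofReal (d - c) := by
  have hu : UniqueMDiffOn 𝓘(ℝ, ℝ) (Icc a b) := (uniqueDiffOn_Icc hab).uniqueMDiffOn
  have h1 : ContinuousOn (fun t : ℝ ↦ (⟨γ t, mfderivWithin 𝓘(ℝ, ℝ) 𝓘(ℝ, E) γ (Icc a b) t 1⟩ :
      TotalSpace E (fun x : M ↦ TangentSpace 𝓘(ℝ, E) x))) (Icc a b) := by
    have h2 : Continuous (fun t : ℝ ↦ (⟨t, 1⟩ : TangentBundle 𝓘(ℝ, ℝ) ℝ)) :=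
      (tangentBundleModelSpaceHomeomorph 𝓘(ℝ, ℝ)).symm.continuous.comp
        (continuous_id.prodMk continuous_const)
    exact (hγ.continuousOn_tangentMapWithin le_rfl hu).comp h2.continuousOn fun t ht ↦ ht
  have h3 := h1.inner_bundle h1
  -- `C` bounds the squared speed, whence the constant `√C`. Passing to the open interval avoids the
  -- endpoints, where `mfderiv` and `mfderivWithin` may differ.
  obtain ⟨C, hC⟩ := isCompact_Icc.exists_bound_of_continuousOn h3
  refine ⟨Real.toNNReal (Real.sqrt C), fun c d hc hd ↦ ?_⟩
  rw [pathELength_eq_lintegral_mfderiv_Ioo]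
  calc _ ≤ ∫⁻ t in Ioo c d, (Real.toNNReal (Real.sqrt C) : ℝ≥0∞) := by
        refine MeasureTheory.setLIntegral_mono' measurableSet_Ioo fun t ht ↦ ?_
        have ht' : t ∈ Ioo a b := ⟨hc.trans_lt ht.1, ht.2.trans_le hd⟩
        have h4 := hC t ⟨ht'.1.le, ht'.2.le⟩
        rw [mfderivWithin_of_mem_nhds (Icc_mem_nhds ht'.1 ht'.2), real_inner_self_eq_norm_sq,
          norm_pow, norm_norm] at h4
        rw [enorm_eq_nnnorm, ENNReal.coe_le_coe]
        exact NNReal.le_toNNReal_of_coe_le (Real.le_sqrt_of_sq_le h4)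
    _ = _ := by simp

variable [RiemannianBundle (fun x : S ↦ TangentSpace 𝓘(ℝ, E) x)]

/-- If `f` contracts no tangent vector by more than a factor `C`, the length of a path is at most
`C` times the length of its image. -/
theorem pathELength_le_mul_of_lift {C : ℝ≥0∞} (hC : C ≠ ⊤)
    (hf : MDifferentiable 𝓘(ℝ, E) 𝓘(ℝ, E) f)
    (hfC : ∀ (p : S) (v : TangentSpace 𝓘(ℝ, E) p), ‖v‖ₑ ≤ C * ‖mfderiv 𝓘(ℝ, E) 𝓘(ℝ, E) f p v‖ₑ)
    {γ : ℝ → M} {Γ : ℝ → S} {a b : ℝ} (hΓ : MDifferentiableOn 𝓘(ℝ, ℝ) 𝓘(ℝ, E) Γ (Ioo a b))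
    (hlift : ∀ t ∈ Ioo a b, f (Γ t) = γ t) :
    pathELength 𝓘(ℝ, E) Γ a b ≤ C * pathELength 𝓘(ℝ, E) γ a b := by
  rw [← pathELength_congr_Ioo (γ := f ∘ Γ) hlift, pathELength_eq_lintegral_mfderiv_Ioo,
    pathELength_eq_lintegral_mfderiv_Ioo, ← MeasureTheory.lintegral_const_mul' _ _ hC]
  refine MeasureTheory.setLIntegral_mono' measurableSet_Ioo fun t ht ↦ ?_
  rw [mfderiv_comp t (hf _) ((hΓ t ht).mdifferentiableAt (Ioo_mem_nhds ht.1 ht.2))]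
  exact hfC _ _

variable (E S) in
/-- Completeness of a Riemannian manifold, in terms of sequences and of its Riemannian distance. -/
def IsRiemannianComplete : Prop :=
  ∀ u : ℕ → S,
    (∀ ε : ℝ≥0∞, 0 < ε → ∃ N : ℕ, ∀ i ≥ N, ∀ j ≥ N, riemannianEDist 𝓘(ℝ, E) (u i) (u j) < ε) →
    ∃ x : S, Tendsto (fun i ↦ riemannianEDist 𝓘(ℝ, E) (u i) x) atTop (𝓝 0)

section Topology

variable [IsManifold 𝓘(ℝ, E) 1 S]
  [IsContinuousRiemannianBundle E (fun x : S ↦ TangentSpace 𝓘(ℝ, E) x)]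

/-- The distance of a continuous Riemannian metric induces the manifold topology. This translates
between metric completeness and the topological limits used for lifting. -/
theorem tendsto_riemannianEDist_zero_iff [RegularSpace S] {ι : Type*} {l : Filter ι} {u : ι → S}
    {x : S} :
    Tendsto (fun i ↦ riemannianEDist 𝓘(ℝ, E) (u i) x) l (𝓝 0) ↔ Tendsto u l (𝓝 x) := by
  let : PseudoEMetricSpace S := .ofRiemannianMetric 𝓘(ℝ, E) S
  exact (tendsto_iff_edist_tendsto_0 (f := u) (y := x)).symm

end Topology

variable [IsManifold 𝓘(ℝ, E) 1 S] [IsManifold 𝓘(ℝ, E) 1 M]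
  [IsContinuousRiemannianBundle E (fun x : S ↦ TangentSpace 𝓘(ℝ, E) x)]
  [IsContinuousRiemannianBundle E (fun x : M ↦ TangentSpace 𝓘(ℝ, E) x)]

/-- A local diffeomorphism from a complete Riemannian manifold that contracts no tangent vector by
more than a fixed factor lifts `C^1` paths. -/
theorem IsLocalDiffeomorph.exists_lift_of_isRiemannianComplete [T2Space S] [RegularSpace S]
    [T2Space M] (hf : IsLocalDiffeomorph 𝓘(ℝ, E) 𝓘(ℝ, E) 1 f) (hS : IsRiemannianComplete E S)
    {C : ℝ≥0∞} (hC : C ≠ ⊤)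
    (hfC : ∀ (p : S) (v : TangentSpace 𝓘(ℝ, E) p), ‖v‖ₑ ≤ C * ‖mfderiv 𝓘(ℝ, E) 𝓘(ℝ, E) f p v‖ₑ)
    {γ : ℝ → M} {a b : ℝ} (hab : a < b) (hγ : ContMDiffOn 𝓘(ℝ, ℝ) 𝓘(ℝ, E) 1 γ (Icc a b))
    {p : S} (hp : f p = γ a) :
    ∃ Γ : ℝ → S, ContMDiffOn 𝓘(ℝ, ℝ) 𝓘(ℝ, E) 1 Γ (Icc a b) ∧ Γ a = p ∧
      (∀ t ∈ Icc a b, f (Γ t) = γ t) ∧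
      riemannianEDist 𝓘(ℝ, E) p (Γ b) ≤ C * pathELength 𝓘(ℝ, E) γ a b := by
  have hlen : ∀ (Γ : ℝ → S) (c d : ℝ), a ≤ c → c ≤ d → d ≤ b → ContinuousOn Γ (Icc c d) →
      (∀ t ∈ Icc c d, f (Γ t) = γ t) →
      riemannianEDist 𝓘(ℝ, E) (Γ c) (Γ d) ≤ C * pathELength 𝓘(ℝ, E) γ c d := by
    intro Γ c d hac hcd hdb hΓ hlift
    have hΓ' := hf.contMDiffOn_lift (hγ.mono (Icc_subset_Icc hac hdb)) hΓ hlift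
    refine (riemannianEDist_le_pathELength hΓ' rfl rfl hcd).trans ?_
    exact pathELength_le_mul_of_lift hC (hf.mdifferentiable one_ne_zero) hfC
      ((hΓ'.mdifferentiableOn one_ne_zero).mono Ioo_subset_Icc_self)
      fun t ht ↦ hlift t (Ioo_subset_Icc_self ht)
  obtain ⟨K, hK⟩ := exists_pathELength_le_mul_sub hab hγ
  obtain ⟨Γ, h1, h2, h3⟩ := hf.isLocalHomeomorph.exists_lift_of_forall_mapClusterPt hab.le
    hγ.continuousOn hp (fun s hs Γ hΓ hlift ↦ by
      obtain ⟨u, hu, hus, hlim⟩ := exists_seq_strictMono_tendsto' hs.1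
      have hlim' : Tendsto u atTop (𝓝[<] s) :=
        tendsto_nhdsWithin_iff.2 ⟨hlim, .of_forall fun i ↦ (hus i).2⟩
      -- The bound depends on `i` alone and tends to `0` as `u i → s`, so the lifted points form a
      -- Cauchy sequence; its limit is the required cluster point.
      have hdist : ∀ i j, i ≤ j → riemannianEDist 𝓘(ℝ, E) (Γ (u i)) (Γ (u j)) ≤
          C * (K * ENNReal.ofReal (s - u i)) := by
        intro i j hij
        have hsub : Icc (u i) (u j) ⊆ Ico a s := fun t ht ↦
          ⟨(hus i).1.le.trans ht.1, ht.2.trans_lt (hus j).2⟩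
        refine (hlen Γ (u i) (u j) (hus i).1.le (hu.monotone hij) ((hus j).2.le.trans hs.2)
          (hΓ.mono hsub) fun t ht ↦ hlift t (hsub ht)).trans ?_
        gcongr
        refine (hK _ _ (hus i).1.le ((hus j).2.le.trans hs.2)).trans ?_
        gcongr
        exact (hus j).2.le
      have hzero : Tendsto (fun i ↦ C * (K * ENNReal.ofReal (s - u i))) atTop (𝓝 0) := by
        have h4 : Tendsto (fun i ↦ ENNReal.ofReal (s - u i)) atTop (𝓝 0) := by
          simpa using ENNReal.tendsto_ofReal (tendsto_const_nhds.sub hlim : Tendsto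
            (fun i ↦ s - u i) atTop (𝓝 (s - s)))
        simpa using ENNReal.Tendsto.const_mul (ENNReal.Tendsto.const_mul h4
          (.inr ENNReal.coe_ne_top)) (.inr hC)
      obtain ⟨x, hx⟩ := hS (fun i ↦ Γ (u i)) fun ε hε ↦ by
        obtain ⟨N, hN⟩ := eventually_atTop.1 (hzero.eventually (gt_mem_nhds hε))
        refine ⟨N, fun i hi j hj ↦ ?_⟩
        rcases le_total i j with hij | hij
        · exact (hdist i j hij).trans_lt (hN i hi)
        · rw [riemannianEDist_comm]
          exact (hdist j i hij).trans_lt (hN j hj)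
      have hx' : Tendsto (fun i ↦ Γ (u i)) atTop (𝓝 x) := tendsto_riemannianEDist_zero_iff.1 hx
      exact ⟨x, (hx'.mapClusterPt).of_comp hlim'⟩)
  refine ⟨Γ, hf.contMDiffOn_lift hγ h1 h3, h2, h3, ?_⟩
  have := hlen Γ a b le_rfl hab.le le_rfl h1 h3
  rwa [h2] at this

end Riemannian

/-! ### Covering maps and completeness of the target -/

/-- A covering map from a nonempty space to a connected space is surjective. -/
theorem IsCoveringMap.surjective {E X : Type*} [TopologicalSpace E] [TopologicalSpace X]
    [Nonempty E] [PreconnectedSpace X] {f : E → X} (hf : IsCoveringMap f) :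
    Function.Surjective f := by
  rw [← range_eq_univ]
  refine IsClopen.eq_univ ⟨⟨?_⟩, hf.isOpenMap.isOpen_range⟩ (range_nonempty f)
  refine isOpen_iff_mem_nhds.2 fun x hx ↦ ?_
  obtain ⟨-, U, hxU, hU, -, H, -⟩ := hf x
  filter_upwards [hU.mem_nhds hxU]
  -- If the evenly covered set `U` met the range, the trivialization over `U` would produce a point
  -- of the fibre over `x`, which is empty.
  rintro _ hy ⟨e, rfl⟩
  exact hx ⟨(H ⟨e, hy⟩).2, (H ⟨e, hy⟩).2.2⟩

section Riemannian

variable {E : Type*} [NormedAddCommGroup E] [NormedSpace ℝ E]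
  {M : Type*} [TopologicalSpace M] [ChartedSpace E M]
  {S : Type*} [TopologicalSpace S] [ChartedSpace E S] {f : S → M}
  [RiemannianBundle (fun x : M ↦ TangentSpace 𝓘(ℝ, E) x)]
  [RiemannianBundle (fun x : S ↦ TangentSpace 𝓘(ℝ, E) x)]
  [IsManifold 𝓘(ℝ, E) 1 S] [IsManifold 𝓘(ℝ, E) 1 M]
  [IsContinuousRiemannianBundle E (fun x : S ↦ TangentSpace 𝓘(ℝ, E) x)]
  [IsContinuousRiemannianBundle E (fun x : M ↦ TangentSpace 𝓘(ℝ, E) x)]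
  [T2Space S] [RegularSpace S] [T2Space M]

open unitInterval in
/-- A local diffeomorphism from a complete Riemannian manifold that contracts no tangent vector by
more than a fixed factor is a covering map. -/
theorem IsLocalDiffeomorph.isCoveringMap_of_isRiemannianComplete
    (hf : IsLocalDiffeomorph 𝓘(ℝ, E) 𝓘(ℝ, E) 1 f) (hS : IsRiemannianComplete E S)
    {C : ℝ≥0∞} (hC : C ≠ ⊤)
    (hfC : ∀ (p : S) (v : TangentSpace 𝓘(ℝ, E) p),
      ‖v‖ₑ ≤ C * ‖mfderiv 𝓘(ℝ, E) 𝓘(ℝ, E) f p v‖ₑ) :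
    IsCoveringMap f := by
  intro x
  let φ := chartAt E x
  obtain ⟨r, hr, hball⟩ := Metric.isOpen_iff.1 φ.open_target (φ x) (mem_chart_target E x)
  let U : Set M := φ.source ∩ φ ⁻¹' Metric.ball (φ x) r
  have hU : IsOpen U := φ.isOpen_inter_preimage Metric.isOpen_ball
  -- Radial segments in a ball of the chart: convexity keeps them in `φ.target`, and each is smooth
  -- in `t`, so its image in `M` can be lifted.
  let η : E → ℝ → E := fun z t ↦ φ x + t • (z - φ x)
  have hη : ∀ (y : U) (t : ℝ), t ∈ Icc (0 : ℝ) 1 → η (φ y) t ∈ φ.target := fun y t ht ↦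
    hball ((convex_ball (φ x) r).add_smul_sub_mem (Metric.mem_ball_self hr) y.2.2 ht)
  have hφU : Continuous fun y : U ↦ φ y :=
    φ.continuousOn.comp_continuous continuous_subtype_val fun y ↦ y.2.1
  let c : C(I × U, M) := ⟨fun q ↦ φ.symm (η (φ q.2) q.1),
    φ.continuousOn_symm.comp_continuous (continuous_const.add
      ((continuous_subtype_val.comp continuous_fst).smul
        ((hφU.comp continuous_snd).sub continuous_const))) fun q ↦ hη q.2 q.1 q.1.2⟩
  have hsmooth : ∀ y : U, ContMDiffOn 𝓘(ℝ, ℝ) 𝓘(ℝ, E) 1 (fun t ↦ φ.symm (η (φ y) t))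
      (Icc 0 1) := fun y ↦ by
    refine contMDiffOn_chart_symm.comp (t := φ.target) (ContDiff.contMDiff ?_).contMDiffOn (hη y)
    fun_prop
  have hrestr : ∀ {Γ : ℝ → S}, ContMDiffOn 𝓘(ℝ, ℝ) 𝓘(ℝ, E) 1 Γ (Icc 0 1) →
      Continuous fun t : I ↦ Γ t := fun h ↦
    h.continuousOn.comp_continuous continuous_subtype_val fun t ↦ t.2
  refine hf.isLocalHomeomorph.isEvenlyCovered_of_contraction hU
    ⟨mem_chart_source E x, Metric.mem_ball_self hr⟩ c (fun y ↦ ?_) (fun y ↦ ?_)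
    (fun y e he ↦ ?_) (fun y e he ↦ ?_)
  · simp [c, η, φ]
  · simp [c, η, φ.left_inv y.2.1]
  · obtain ⟨Γ, h1, h2, h3, -⟩ := hf.exists_lift_of_isRiemannianComplete hS hC hfC zero_lt_one
      (hsmooth y) (p := e) (by simp [he, η, φ])
    exact ⟨⟨fun t ↦ Γ t, hrestr h1⟩, h2, fun t ↦ h3 t t.2⟩
  -- A lift with prescribed end is the reversal of a lift of the reversed segment.
  · have hrev : ContMDiffOn 𝓘(ℝ, ℝ) 𝓘(ℝ, E) 1 (fun t ↦ φ.symm (η (φ y) (1 - t))) (Icc 0 1) := by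
      refine (hsmooth y).comp (t := Icc 0 1) (f := fun t : ℝ ↦ 1 - t)
        (ContDiff.contMDiff (by fun_prop)).contMDiffOn fun t ht ↦ ?_
      exact ⟨by linarith [ht.2], by linarith [ht.1]⟩
    obtain ⟨Γ, h1, h2, h3, -⟩ := hf.exists_lift_of_isRiemannianComplete hS hC hfC zero_lt_one
      hrev (p := e) (by simp [he, η, φ.left_inv y.2.1])
    refine ⟨⟨fun t ↦ Γ (σ t), (hrestr h1).comp continuous_symm⟩, by simpa using h2, fun t ↦ ?_⟩
    exact (h3 (σ t) (σ t).2).trans (by simp [c])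

/-- The target of a surjective local diffeomorphism from a complete Riemannian manifold that
contracts no tangent vector by more than a fixed factor is complete. -/
theorem IsLocalDiffeomorph.isRiemannianComplete_of_surjective [RegularSpace M]
    (hf : IsLocalDiffeomorph 𝓘(ℝ, E) 𝓘(ℝ, E) 1 f) (hS : IsRiemannianComplete E S)
    {C : ℝ≥0∞} (hC : C ≠ ⊤)
    (hfC : ∀ (p : S) (v : TangentSpace 𝓘(ℝ, E) p),
      ‖v‖ₑ ≤ C * ‖mfderiv 𝓘(ℝ, E) 𝓘(ℝ, E) f p v‖ₑ)
    (hsurj : Function.Surjective f) :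
    IsRiemannianComplete E M := by
  -- The strict inequality supplies a path of length less than `r`; no minimizing path is needed.
  have step : ∀ (p : S) (y : M) (r : ℝ≥0∞), riemannianEDist 𝓘(ℝ, E) (f p) y < r →
      ∃ q, f q = y ∧ riemannianEDist 𝓘(ℝ, E) p q ≤ C * r := by
    intro p y r hr
    obtain ⟨γ, h0, h1, hγ, hlen⟩ := exists_lt_of_riemannianEDist_lt hr
    obtain ⟨Γ, -, -, h2, h3⟩ := hf.exists_lift_of_isRiemannianComplete hS hC hfC zero_lt_one hγ
      h0.symm
    exact ⟨Γ 1, (h2 1 (by simp)).trans h1, h3.trans (by gcongr)⟩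
  let : PseudoEMetricSpace M := .ofRiemannianMetric 𝓘(ℝ, E) M
  let : PseudoEMetricSpace S := .ofRiemannianMetric 𝓘(ℝ, E) S
  have hM : CompleteSpace M := by
    -- It suffices to treat sequences whose `k`-th step is shorter than `1 / 2 ^ k`: their
    -- successive lifts move by at most `C / 2 ^ k`, which is summable.
    refine EMetric.complete_of_convergent_controlled_sequences (fun k ↦ 1 / 2 ^ k)
      (fun k ↦ by simp) fun u hu ↦ ?_
    obtain ⟨p, hp⟩ := hsurj (u 0)
    have hnext : ∀ (k : ℕ) (q : {q : S // f q = u k}), ∃ q' : {q : S // f q = u (k + 1)},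
        edist q.1 q'.1 ≤ C / 2 ^ k := by
      rintro k ⟨q, hq⟩
      obtain ⟨q', h1, h2⟩ := step q (u (k + 1)) (1 / 2 ^ k)
        (by rw [hq]; exact hu k k (k + 1) le_rfl k.le_succ)
      exact ⟨⟨q', h1⟩, h2.trans_eq (by simp [div_eq_mul_inv])⟩
    choose next hnext using hnext
    let q : ∀ k, {q : S // f q = u k} := fun k ↦ Nat.rec ⟨p, hp⟩ (fun k q ↦ next k q) k
    have hq : CauchySeq fun k ↦ (q k).1 :=
      cauchySeq_of_edist_le_geometric_two C hC fun k ↦ hnext k (q k)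
    obtain ⟨x, hx⟩ := hS (fun k ↦ (q k).1) fun ε hε ↦ EMetric.cauchySeq_iff.1 hq ε hε
    have hx' : Tendsto (fun k ↦ (q k).1) atTop (𝓝 x) := tendsto_riemannianEDist_zero_iff.1 hx
    refine ⟨f x, ((hf.isLocalHomeomorph.continuous.tendsto x).comp hx').congr fun k ↦ (q k).2⟩
  intro u hu
  obtain ⟨x, hx⟩ := cauchySeq_tendsto_of_complete
    (EMetric.cauchySeq_iff.2 fun ε hε ↦ hu ε hε : CauchySeq u)
  exact ⟨x, tendsto_riemannianEDist_zero_iff.2 hx⟩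

end Riemannian

/-! ### Geometry of the projection of a spacelike hypersurface -/

namespace SteadyState

variable {n : ℕ} {M : Type*} [TopologicalSpace M] [ChartedSpace (EuclideanSpace ℝ (Fin n)) M]
  [IsManifold (𝓡 n) ∞ M] {S : Type*} [TopologicalSpace S]
  [ChartedSpace (EuclideanSpace ℝ (Fin n)) S]
  {g : SmoothMetric n M} {ψ : S → ℝ × M}

theorem isContinuousRiemannianBundle (g : SmoothMetric n M) :
    letI : RiemannianBundle (fun x : M ↦ TangentSpace (𝓡 n) x) := ⟨g.toRiemannianMetric⟩
    IsContinuousRiemannianBundle (EuclideanSpace ℝ (Fin n)) (fun x : M ↦ TangentSpace (𝓡 n) x) :=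
  letI : RiemannianBundle (fun x : M ↦ TangentSpace (𝓡 n) x) := ⟨g.toRiemannianMetric⟩
  ⟨g.inner, g.contMDiff.continuous, fun _ _ _ ↦ rfl⟩

theorem IsSpacelike.contMDiff_fst (h : IsSpacelike g ψ) :
    ContMDiff (𝓡 n) 𝓘(ℝ, ℝ) ∞ (fun p ↦ (ψ p).1) :=
  _root_.contMDiff_fst.comp h.contMDiff

theorem IsSpacelike.contMDiff_snd (h : IsSpacelike g ψ) :
    ContMDiff (𝓡 n) (𝓡 n) ∞ (fun p ↦ (ψ p).2) :=
  _root_.contMDiff_snd.comp h.contMDiff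

/-- The differential of the time component of a map to `ℝ × M`. -/
noncomputable def timeDeriv (ψ : S → ℝ × M) (p : S) : TangentSpace (𝓡 n) p →L[ℝ] ℝ :=
  mfderiv (𝓡 n) 𝓘(ℝ, ℝ) (fun p ↦ (ψ p).1) p

theorem IsSpacelike.dTime_mfderiv (h : IsSpacelike g ψ) (p : S) (v : TangentSpace (𝓡 n) p) :
    dTime (n := n) (ψ p) (mfderiv (𝓡 n) (𝓘(ℝ, ℝ).prod (𝓡 n)) ψ p v) =
      timeDeriv (n := n) ψ p v := by
  have := mfderiv_comp (I' := 𝓘(ℝ, ℝ).prod (𝓡 n)) p (mdifferentiableAt_fst (x := ψ p))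
    (h.contMDiff.mdifferentiableAt (by simp) (x := p))
  exact (DFunLike.congr_fun this v).symm

theorem IsSpacelike.dSpace_mfderiv (h : IsSpacelike g ψ) (p : S) (v : TangentSpace (𝓡 n) p) :
    dSpace (ψ p) (mfderiv (𝓡 n) (𝓘(ℝ, ℝ).prod (𝓡 n)) ψ p v) =
      mfderiv (𝓡 n) (𝓡 n) (fun p ↦ (ψ p).2) p v := by
  have := mfderiv_comp (I' := 𝓘(ℝ, ℝ).prod (𝓡 n)) p (mdifferentiableAt_snd (x := ψ p))
    (h.contMDiff.mdifferentiableAt (by simp) (x := p))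
  exact (DFunLike.congr_fun this v).symm

/-- The induced metric in terms of the two components of the hypersurface. -/
theorem IsSpacelike.pullback_eq (h : IsSpacelike g ψ) (p : S) (v w : TangentSpace (𝓡 n) p) :
    pullback g ψ p v w =
      -(timeDeriv ψ p v * timeDeriv ψ p w) +
      Real.exp (2 * (ψ p).1) * g.inner (ψ p).2 (mfderiv (𝓡 n) (𝓡 n) (fun p ↦ (ψ p).2) p v)
        (mfderiv (𝓡 n) (𝓡 n) (fun p ↦ (ψ p).2) p w) := by
  simp only [pullback, lorentz, h.dTime_mfderiv, h.dSpace_mfderiv]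

/-- The discarded time term is minus a square. This inequality yields both the injectivity of the
differential of the projection and the bound on its contraction. -/
theorem IsSpacelike.pullback_self_le (h : IsSpacelike g ψ) (p : S) (v : TangentSpace (𝓡 n) p) :
    pullback g ψ p v v ≤ Real.exp (2 * (ψ p).1) *
      g.inner (ψ p).2 (mfderiv (𝓡 n) (𝓡 n) (fun p ↦ (ψ p).2) p v)
        (mfderiv (𝓡 n) (𝓡 n) (fun p ↦ (ψ p).2) p v) := by
  rw [h.pullback_eq]
  linarith [mul_self_nonneg (timeDeriv ψ p v)]

/-- A nonzero vector killed by the projection would be tangent to the time axis and have nonpositive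
square, against spacelikeness. Equality of dimensions upgrades injectivity to bijectivity. -/
theorem IsSpacelike.bijective_mfderiv_snd (h : IsSpacelike g ψ) (p : S) :
    Function.Bijective (mfderiv (𝓡 n) (𝓡 n) (fun p ↦ (ψ p).2) p) := by
  let A : EuclideanSpace ℝ (Fin n) →L[ℝ] EuclideanSpace ℝ (Fin n) :=
    mfderiv (𝓡 n) (𝓡 n) (fun p ↦ (ψ p).2) p
  have hA : Function.Injective A := by
    refine (injective_iff_map_eq_zero A).2 fun v hv ↦ ?_
    by_contra hne
    have h1 := h.pos p v hne
    have h2 := h.pullback_self_le p v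
    have hv' : mfderiv (𝓡 n) (𝓡 n) (fun p ↦ (ψ p).2) p v = 0 := hv
    rw [hv'] at h2
    simp only [map_zero, mul_zero] at h2
    exact absurd h2 h1.not_ge
  exact ⟨hA, (LinearMap.injective_iff_surjective (f := A.toLinearMap)).1 hA⟩

theorem IsSpacelike.isLocalDiffeomorph_snd [IsManifold (𝓡 n) ∞ S] (h : IsSpacelike g ψ) :
    IsLocalDiffeomorph (𝓡 n) (𝓡 n) ∞ (fun p ↦ (ψ p).2) := fun p ↦
  h.contMDiff_snd.isLocalDiffeomorphAt (by simp) (h.bijective_mfderiv_snd p)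

/-- If `ψ` stays below the slice `t = T`, then its projection to `M` contracts no tangent vector by
more than the factor `e ^ T`. -/
theorem IsSpacelike.enorm_le (h : IsSpacelike g ψ) {T : ℝ} (hT : ∀ p, (ψ p).1 ≤ T) (p : S)
    (v : TangentSpace (𝓡 n) p) :
    letI : RiemannianBundle (fun x : M ↦ TangentSpace (𝓡 n) x) := ⟨g.toRiemannianMetric⟩
    letI : RiemannianBundle (fun x : S ↦ TangentSpace (𝓡 n) x) := ⟨h.induced⟩
    ‖v‖ₑ ≤ ENNReal.ofReal (Real.exp T) * ‖mfderiv (𝓡 n) (𝓡 n) (fun p ↦ (ψ p).2) p v‖ₑ := by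
  let : RiemannianBundle (fun x : M ↦ TangentSpace (𝓡 n) x) := ⟨g.toRiemannianMetric⟩
  let : RiemannianBundle (fun x : S ↦ TangentSpace (𝓡 n) x) := ⟨h.induced⟩
  set w := mfderiv (𝓡 n) (𝓡 n) (fun p ↦ (ψ p).2) p v
  have h1 : ‖v‖ ^ 2 = pullback g ψ p v v := (real_inner_self_eq_norm_sq v).symm
  have h2 : ‖w‖ ^ 2 = g.inner (ψ p).2 w w := (real_inner_self_eq_norm_sq w).symm
  have h3 : ‖v‖ ^ 2 ≤ (Real.exp T * ‖w‖) ^ 2 := by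
    rw [h1, mul_pow, h2, ← Real.exp_nat_mul]
    refine (h.pullback_self_le p v).trans ?_
    have h4 : 0 ≤ g.inner (ψ p).2 w w := h2 ▸ sq_nonneg _
    refine mul_le_mul_of_nonneg_right (Real.exp_le_exp.2 ?_) h4
    push_cast
    linarith [hT p]
  have h5 : ‖v‖ ≤ Real.exp T * ‖w‖ := le_of_sq_le_sq h3 (by positivity)
  rw [← ofReal_norm, ← ofReal_norm, ← ENNReal.ofReal_mul (Real.exp_pos T).le]
  exact ENNReal.ofReal_le_ofReal h5

/-- The induced metric is continuous. -/
theorem IsSpacelike.continuous_induced [IsManifold (𝓡 n) ∞ S] (h : IsSpacelike g ψ) :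
    Continuous (fun p : S ↦ TotalSpace.mk'
      (EuclideanSpace ℝ (Fin n) →L[ℝ] EuclideanSpace ℝ (Fin n) →L[ℝ] ℝ)
      (E := fun p : S ↦ TangentSpace (𝓡 n) p →L[ℝ] TangentSpace (𝓡 n) p →L[ℝ] ℝ) p
      (h.induced.inner p)) := by
  refine continuous_iff_continuousAt.2 fun p ↦ ?_
  let e := trivializationAt (EuclideanSpace ℝ (Fin n)) (fun p : S ↦ TangentSpace (𝓡 n) p) p
  have hp : p ∈ e.baseSet := FiberBundle.mem_baseSet_trivializationAt' p
  -- Local fields that are constant in the trivialization at `p`. In finite dimension, continuity of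
  -- the form reduces to continuity of its values on pairs of such fields.
  let V : EuclideanSpace ℝ (Fin n) → ∀ q : S, TangentSpace (𝓡 n) q := fun v q ↦ e.symm q v
  have hV : ∀ v, ContinuousAt (fun q ↦ (⟨q, V v q⟩ : TangentBundle (𝓡 n) S)) p := fun v ↦ by
    have h1 : ContinuousAt (fun q : S × EuclideanSpace ℝ (Fin n) ↦
        (⟨q.1, e.symm q.1 q.2⟩ : TangentBundle (𝓡 n) S)) (p, v) :=
      e.continuousOn_symm.continuousAt ((e.open_baseSet.prod isOpen_univ).mem_nhds ⟨hp, trivial⟩)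
    exact h1.comp (f := fun q ↦ (q, v)) (by fun_prop)
  have htime : ∀ v, ContinuousAt (fun q ↦ timeDeriv ψ q (V v q)) p := fun v ↦ by
    have h1 := (h.contMDiff_fst.continuous_tangentMap (by simp)).continuousAt.comp (hV v)
    have h2 := (tangentBundleModelSpaceHomeomorph 𝓘(ℝ, ℝ)).continuous.continuousAt.comp h1
    exact continuousAt_snd.comp h2
  have hspace : ∀ v, ContinuousAt (fun q ↦ (⟨(ψ q).2, mfderiv (𝓡 n) (𝓡 n) (fun p ↦ (ψ p).2) q
      (V v q)⟩ : TotalSpace (EuclideanSpace ℝ (Fin n)) (fun x : M ↦ TangentSpace (𝓡 n) x))) p :=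
    fun v ↦ (h.contMDiff_snd.continuous_tangentMap (by simp)).continuousAt.comp (hV v)
  have hexp : Continuous fun q ↦ Real.exp (2 * (ψ q).1) :=
    Real.continuous_exp.comp (continuous_const.mul h.contMDiff_fst.continuous)
  have hpull : ∀ v w, ContinuousAt (fun q ↦ pullback g ψ q (V v q) (V w q)) p := fun v w ↦ by
    let : RiemannianBundle (fun x : M ↦ TangentSpace (𝓡 n) x) := ⟨g.toRiemannianMetric⟩
    have := isContinuousRiemannianBundle g
    simp only [h.pullback_eq]
    exact ((htime v).mul (htime w)).neg.add
      (hexp.continuousAt.mul ((hspace v).inner_bundle (hspace w)))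
  rw [continuousAt_hom_bundle]
  refine ⟨continuousAt_id, ?_⟩
  refine continuousAt_clm_apply.2 fun v ↦ continuousAt_clm_apply.2 fun w ↦ ?_
  refine (hpull v w).congr ?_
  filter_upwards [e.open_baseSet.mem_nhds hp] with q hq
  rw [inCoordinates_apply_eq₂ hq hq (mem_univ _)]
  simp
  rfl

end SteadyState

theorem mainTheorem5 (n : ℕ)
    {M : Type*} [TopologicalSpace M] [T2Space M] [ConnectedSpace M]
    [ChartedSpace (EuclideanSpace ℝ (Fin n)) M] [IsManifold (𝓡 n) ∞ M]
    (g : SteadyState.SmoothMetric n M)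
    {S : Type*} [TopologicalSpace S] [T2Space S] [ConnectedSpace S]
    [ChartedSpace (EuclideanSpace ℝ (Fin n)) S] [IsManifold (𝓡 n) ∞ S]
    (ψ : S → ℝ × M) (hψ : SteadyState.IsSpacelike g ψ)
    (hcomplete : SteadyState.IsCompleteMetric hψ.induced)
    (hbdd : SteadyState.IsBoundedAwayFromFuture ψ) :
    SteadyState.IsCompleteMetric g.toRiemannianMetric ∧
      Function.Surjective (fun p ↦ (ψ p).2) ∧
      IsCoveringMap (fun p ↦ (ψ p).2) ∧
      IsLocalDiffeomorph (𝓡 n) (𝓡 n) ∞ (fun p ↦ (ψ p).2) := by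
  obtain ⟨T, hT⟩ := hbdd
  -- Together with the Hausdorff property, local compactness gives the regularity under which the
  -- Riemannian distance induces the topology.
  have : LocallyCompactSpace M := ChartedSpace.locallyCompactSpace (EuclideanSpace ℝ (Fin n)) M
  have : LocallyCompactSpace S := ChartedSpace.locallyCompactSpace (EuclideanSpace ℝ (Fin n)) S
  have : IsManifold (𝓡 n) 1 M := .of_le (n := ∞) (by simp)
  have : IsManifold (𝓡 n) 1 S := .of_le (n := ∞) (by simp)
  let : RiemannianBundle (fun x : M ↦ TangentSpace (𝓡 n) x) := ⟨g.toRiemannianMetric⟩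
  let : RiemannianBundle (fun x : S ↦ TangentSpace (𝓡 n) x) := ⟨hψ.induced⟩
  have := SteadyState.isContinuousRiemannianBundle g
  have : IsContinuousRiemannianBundle (EuclideanSpace ℝ (Fin n))
      (fun x : S ↦ TangentSpace (𝓡 n) x) :=
    ⟨hψ.induced.inner, hψ.continuous_induced, fun _ _ _ ↦ rfl⟩
  have hS : IsRiemannianComplete (EuclideanSpace ℝ (Fin n)) S := hcomplete
  have hloc := hψ.isLocalDiffeomorph_snd
  have hloc₁ := hloc.of_le (m := 1) (by simp)
  have hcov := hloc₁.isCoveringMap_of_isRiemannianComplete hS ENNReal.ofReal_ne_top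
    (hψ.enorm_le hT)
  have hsurj := hcov.surjective
  exact ⟨hloc₁.isRiemannianComplete_of_surjective hS ENNReal.ofReal_ne_top (hψ.enorm_le hT) hsurj,
    hsurj, hcov, hloc⟩
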